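/- Let $f,g$ be real analytic functions on an open neighborhood $U$ of $0\in\mathbb R$ with $g(0)=0$, $g'(0)=1$ and $xg(x)>0$ for all $x\ne 0$ close to $0$. For a function $h$ that is real analytic near $0$, define near $0$, for $k\ge 1$, $$\widehat P_0(\xi)=\xi,\qquad \widehat P_k(\xi)=\widehat P_{k-1}'(\xi)\,(1+h(\xi))-(2k-1)\,\widehat P_{k-1}(\xi)\,h'(\xi),$$ $$\widehat Q_0(x)=g(x),\qquad \widehat Q_k(x)=\widehat Q_{k-1}'(x)-(k-2)\,f(x)\,\widehat Q_{k-1}(x).$$ (1) The planar system $\dot x=y$, $\dot y=-g(x)-f(x)y^2$ on $U\times\mathbb R$ (equivalently, the equation $\ddot x+f(x)\dot x^2+g(x)=0$) has an isochronous center at the origin $O$, that is, $O$ is an equilibrium with a punctured neighborhood through every point of which passes a periodic orbit, all these orbits having the same minimal period, if and only if there is a function $h$, real analytic and odd near $0$, such that $\widehat P_k(0)=\widehat Q_k(0)$ for all $k\ge 0$. (2) Moreover, for every integer $M>0$, the first $M$ conditions $\widehat P_k(0)=\widehat Q_k(0)$, $1\le k\le M$, can be obtained by computing the power series expansions of $\widehat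 P_k$ and $\widehat Q_k$ around $0$ only up to the order $M-k$. Precisely, let $h$ be real analytic and odd near $0$, and let $[S]_n$ denote the truncation of a power series $S$ around $0$ after its term of degree $n$. Define polynomials by $p_0=[\xi]_M$, $q_0=[g]_M$ and, for $1\le k\le M$, $$p_k=\big[\,p_{k-1}'\,(1+[h]_{M-k})-(2k-1)\,p_{k-1}\,[h']_{M-k}\,\big]_{M-k},\qquad q_k=\big[\,q_{k-1}'-(k-2)\,[f]_{M-k}\,q_{k-1}\,\big]_{M-k}.$$ Then for all $0\le k\le M$ one has $p_k=[\widehat P_k]_{M-k}$ and $q_k=[\widehat Q_k]_{M-k}$, and $\widehat P_k(0)=\widehat Q_k(0)$ if and only if $p_k(0)=q_k(0)$. -/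

import Mathlib

open scoped Topology

noncomputable section

/-- `γ` is a periodic solution of the autonomous planar system `ż = X z`, defined for all times with
values in the domain `Ω`, whose minimal period is `T` (in particular it is not constant). -/
structure IsPeriodicSolution (X : ℝ × ℝ → ℝ × ℝ) (Ω : Set (ℝ × ℝ)) (T : ℝ) (γ : ℝ → ℝ × ℝ) :
    Prop where
  mem : ∀ t, γ t ∈ Ω
  hasDerivAt : ∀ t, HasDerivAt γ (X (γ t)) t
  period_pos : 0 < T
  periodic : Function.Periodic γ T
  minimal : ∀ s, 0 < s → s < T → ¬ Function.Periodic γ s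

/-- The system `ż = X z` on `Ω` has an isochronous center at `O`: the point `O` is an equilibrium,
a punctured neighborhood of `O` consists of periodic (nonconstant) orbits, and all these orbits
have the same minimal period `T`. -/
def HasIsochronousCenter (X : ℝ × ℝ → ℝ × ℝ) (Ω : Set (ℝ × ℝ)) (O : ℝ × ℝ) : Prop :=
  X O = 0 ∧ ∃ T : ℝ, ∃ V ∈ 𝓝 O, ∀ p ∈ V, p ≠ O →
    ∃ γ : ℝ → ℝ × ℝ, IsPeriodicSolution X Ω T γ ∧ γ 0 = p

/-- The planar system `ẋ = y`, `ẏ = -g(x) - f(x) y²` of the equation `ẍ + f(x) ẋ² + g(x) = 0`. -/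
def lienardField (f g : ℝ → ℝ) (z : ℝ × ℝ) : ℝ × ℝ :=
  (z.2, -g z.1 - f z.1 * z.2 ^ 2)

/-- `h` is an odd real analytic function near `0`. -/
def IsOddAnalytic (h : ℝ → ℝ) : Prop :=
  AnalyticAt ℝ h 0 ∧ ∀ᶠ ξ in 𝓝 (0 : ℝ), h (-ξ) = -h ξ

/-- The functions `P̂ₖ(ξ)`; the coefficient `2k - 1` is written at the index `k + 1`. -/
def Phat (h : ℝ → ℝ) : ℕ → ℝ → ℝ
  | 0 => fun ξ => ξ
  | k + 1 => fun ξ =>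
      deriv (Phat h k) ξ * (1 + h ξ) - (2 * ((k : ℝ) + 1) - 1) * Phat h k ξ * deriv h ξ

/-- The functions `Q̂ₖ(x)`; the coefficient `k - 2` is written at the index `k + 1`. -/
def Qhat (f g : ℝ → ℝ) : ℕ → ℝ → ℝ
  | 0 => g
  | k + 1 => fun x => deriv (Qhat f g k) x - (((k : ℝ) + 1) - 2) * f x * Qhat f g k x

/-- The power series expansion of `F` around `0`. -/
def maclaurin (F : ℝ → ℝ) : PowerSeries ℝ :=
  PowerSeries.mk fun n => iteratedDeriv n F 0 / (n.factorial : ℝ)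

/-- Truncation of a power series up to the order `n`, the term of degree `n` included. -/
def truncAt (n : ℕ) (S : PowerSeries ℝ) : Polynomial ℝ :=
  PowerSeries.trunc (n + 1) S

/-- The recursion for `P̂ₖ` run on truncated series only: at step `k` every series that enters
(that of `h`, that of `h'`, and the result) is truncated up to the order `M - k`. `H` is the power
series of `h`. -/
def PhatTrunc (H : PowerSeries ℝ) (M : ℕ) : ℕ → Polynomial ℝ
  | 0 => truncAt M (PowerSeries.X : PowerSeries ℝ)
  | k + 1 =>
      let n := M - (k + 1)
      let p := PhatTrunc H M k
      let r : Polynomial ℝ := p.derivative * (1 + truncAt n H)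
        - Polynomial.C (2 * ((k : ℝ) + 1) - 1) * p * truncAt n (PowerSeries.derivative ℝ H)
      truncAt n (r : PowerSeries ℝ)

/-- The recursion for `Q̂ₖ` run on truncated series only: at step `k` every series that enters
(that of `f`, and the result) is truncated up to the order `M - k`. `A` and `B` are the power
series of `f` and `g`. -/
def QhatTrunc (A B : PowerSeries ℝ) (M : ℕ) : ℕ → Polynomial ℝ
  | 0 => truncAt M B
  | k + 1 =>
      let n := M - (k + 1)
      let q := QhatTrunc A B M k
      let r : Polynomial ℝ := q.derivative
        - Polynomial.C (((k : ℝ) + 1) - 2) * truncAt n A * q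
      truncAt n (r : PowerSeries ℝ)

end

open scoped Topology

/-! Let F' = f, F(0) = 0 and u = ∫ e^F dx. In the coordinate u the equation reads ü = -G(u) with G =
g e^F, so (ξ² + η²)/2 is conserved, where ξ²/2 = ∫ G du and η = -e^F y. Put 1 + h(ξ) = du/dξ; then G
= ξ/(1 + h(ξ)). On the circle of radius A the angle moves with speed 1/(1 + h(A cos θ)), so the
orbit has period ∫₀^{2π} (1 + h(A cos s)) ds (`IsEnergyChart.exists_periodic`). This is independent
of small A exactly when the even part of h vanishes (`eventually_odd_of_integral_const`,
`hasIsochronousCenter_of_odd`).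

The k-th u-derivative of g e^F is Q̂ₖ e^{(1-k)F}; that of ξ/(1 + h), with u = ∫ (1 + h) dξ, is
P̂ₖ/(1 + h)^{2k+1}. At 0 these equal Q̂ₖ(0) and P̂ₖ(0). Analytic germs agree iff all their
derivatives at 0 do, so the conditions say precisely that h comes from the energy coordinate
(`forall_Phat_eq_Qhat_iff`), which always exists (`exists_isEnergyGerm`).

For (2), a derivative costs one order of a series and a product costs none, so order M - k suffices
at step k. -/

/-! ### Real analytic germs: identity principle, primitives, inverses -/

/-- A real analytic function is determined near `0` by its derivatives at `0`. -/
theorem AnalyticAt.eventuallyEq_of_iteratedDeriv_eq {F G : ℝ → ℝ} (hF : AnalyticAt ℝ F 0)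
    (hG : AnalyticAt ℝ G 0) (h : ∀ n, iteratedDeriv n F 0 = iteratedDeriv n G 0) :
    F =ᶠ[𝓝 0] G := by
  have h1 := hF.hasFPowerSeriesAt
  have h2 := hG.hasFPowerSeriesAt
  simp only [h] at h1
  have h3 := h1.sub h2
  rw [sub_self] at h3
  filter_upwards [h3.eventually_eq_zero] with x hx
  simpa [sub_eq_zero] using hx

theorem AnalyticAt.eventually_hasDerivAt {F : ℝ → ℝ} {x₀ : ℝ} (hF : AnalyticAt ℝ F x₀) :
    ∀ᶠ x in 𝓝 x₀, HasDerivAt F (deriv F x) x :=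
  hF.eventually_analyticAt.mono fun _ hx => hx.differentiableAt.hasDerivAt

/-- A real analytic function has a real analytic primitive. -/
theorem AnalyticAt.exists_primitive {f : ℝ → ℝ} (hf : AnalyticAt ℝ f 0) :
    ∃ F : ℝ → ℝ, AnalyticAt ℝ F 0 ∧ F 0 = 0 ∧ ∀ᶠ x in 𝓝 (0 : ℝ), HasDerivAt F (f x) x := by
  set c : ℕ → ℝ := fun n => iteratedDeriv n f 0 / (n.factorial : ℝ) with hc
  have hp : HasFPowerSeriesAt f (FormalMultilinearSeries.ofScalars ℝ c) 0 := hf.hasFPowerSeriesAt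
  obtain ⟨r, hr0, hr⟩ := ENNReal.lt_iff_exists_nnreal_btwn.1 hp.radius_pos
  obtain ⟨C, hC, hbound⟩ := FormalMultilinearSeries.norm_mul_pow_le_of_lt_radius _ hr
  set b : ℕ → ℝ := fun n => c (n - 1) / n with hb
  set q := FormalMultilinearSeries.ofScalars ℝ b with hq
  have hqr : (r : ENNReal) ≤ q.radius := by
    refine q.le_radius_of_bound (C * r) fun n => ?_
    rw [hq, FormalMultilinearSeries.ofScalars_norm]
    rcases n with _ | n
    · simp only [hb, Nat.cast_zero, div_zero, norm_zero, zero_mul]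
      positivity
    · have h1 := hbound n
      rw [FormalMultilinearSeries.ofScalars_norm] at h1
      have h2 : ‖b (n + 1)‖ ≤ ‖c n‖ := by
        simp only [hb, Nat.add_sub_cancel, norm_div]
        refine div_le_self (norm_nonneg _) ?_
        rw [Real.norm_of_nonneg (by positivity)]
        push_cast
        linarith [(n.cast_nonneg : (0 : ℝ) ≤ n)]
      calc ‖b (n + 1)‖ * (r : ℝ) ^ (n + 1) = ‖b (n + 1)‖ * (r : ℝ) ^ n * r := by ring
        _ ≤ ‖c n‖ * (r : ℝ) ^ n * r := by gcongr
        _ ≤ C * r := by gcongr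
  have hF : HasFPowerSeriesAt q.sum q 0 :=
    (q.hasFPowerSeriesOnBall (hr0.trans_le hqr)).hasFPowerSeriesAt
  have hFa : AnalyticAt ℝ q.sum 0 := hF.analyticAt
  have hcoef : ∀ n, iteratedDeriv n q.sum 0 / (n.factorial : ℝ) = b n := by
    intro n
    have h := hFa.hasFPowerSeriesAt.eq_formalMultilinearSeries hF
    exact congrFun ((FormalMultilinearSeries.ofScalars_series_eq_iff ℝ _ _).1 h) n
  refine ⟨q.sum, hFa, ?_, ?_⟩
  · simpa [hb] using hcoef 0
  · have h : deriv q.sum =ᶠ[𝓝 0] f := by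
      refine hFa.deriv.eventuallyEq_of_iteratedDeriv_eq hf fun n => ?_
      rw [← iteratedDeriv_succ']
      have h1 := hcoef (n + 1)
      simp only [hb, hc, Nat.add_sub_cancel] at h1
      have h2 : ((n + 1).factorial : ℝ) = (n + 1 : ℝ) * n.factorial := by
        rw [Nat.factorial_succ]; push_cast; ring
      have h3 : (n.factorial : ℝ) ≠ 0 := by positivity
      have h4 : (n + 1 : ℝ) ≠ 0 := by positivity
      rw [h2] at h1
      push_cast at h1
      field_simp at h1
      exact h1
    filter_upwards [h, hFa.eventually_hasDerivAt] with x hx hx'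
    rwa [← hx]

/-- The inverse function theorem for real analytic functions tangent to the identity at `0`. -/
theorem AnalyticAt.exists_local_inverse {φ : ℝ → ℝ} (hφ : AnalyticAt ℝ φ 0) (h0 : φ 0 = 0)
    (h1 : deriv φ 0 = 1) :
    ∃ ψ : ℝ → ℝ, AnalyticAt ℝ ψ 0 ∧ ψ 0 = 0 ∧ deriv ψ 0 = 1 ∧
      (∀ᶠ x in 𝓝 (0 : ℝ), ψ (φ x) = x) ∧ ∀ᶠ y in 𝓝 (0 : ℝ), φ (ψ y) = y := by
  -- The exponent `⊤` means analytic, so the smooth inverse function theorem yields an analytic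
  -- inverse.
  have hc : ContDiffAt ℝ ⊤ φ 0 := hφ.contDiffAt
  have hd : HasStrictDerivAt φ 1 0 := by
    simpa [h1] using hφ.hasStrictDerivAt
  have hd' : HasFDerivAt φ
      ((ContinuousLinearEquiv.unitsEquivAut ℝ (Units.mk0 1 one_ne_zero) : ℝ ≃L[ℝ] ℝ) : ℝ →L[ℝ] ℝ)
      0 := (hd.hasStrictFDerivAt_equiv one_ne_zero).hasFDerivAt
  have hψ := (hc.to_localInverse hd' (by simp)).analyticAt
  have hl := hd.eventually_left_inverse one_ne_zero
  have hr := hd.eventually_right_inverse one_ne_zero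
  have hi := hd.to_localInverse one_ne_zero
  rw [h0] at hψ hr hi
  refine ⟨hd.localInverse φ 1 0 one_ne_zero, hψ, ?_, ?_, hl, hr⟩
  · have := hl.self_of_nhds
    rwa [h0] at this
  · simpa using hi.hasDerivAt.deriv

/-! ### Maclaurin series and the truncated recursions -/

theorem coeff_maclaurin (F : ℝ → ℝ) (n : ℕ) :
    PowerSeries.coeff n (maclaurin F) = iteratedDeriv n F 0 / (n.factorial : ℝ) := by
  simp [maclaurin]

theorem maclaurin_add {F G : ℝ → ℝ} (hF : AnalyticAt ℝ F 0) (hG : AnalyticAt ℝ G 0) :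
    maclaurin (fun x => F x + G x) = maclaurin F + maclaurin G := by
  ext n
  rw [map_add, coeff_maclaurin, coeff_maclaurin, coeff_maclaurin,
    iteratedDeriv_fun_add hF.contDiffAt hG.contDiffAt, add_div]

theorem maclaurin_sub {F G : ℝ → ℝ} (hF : AnalyticAt ℝ F 0) (hG : AnalyticAt ℝ G 0) :
    maclaurin (fun x => F x - G x) = maclaurin F - maclaurin G := by
  ext n
  rw [map_sub, coeff_maclaurin, coeff_maclaurin, coeff_maclaurin,
    iteratedDeriv_fun_sub hF.contDiffAt hG.contDiffAt, sub_div]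

theorem maclaurin_mul {F G : ℝ → ℝ} (hF : AnalyticAt ℝ F 0) (hG : AnalyticAt ℝ G 0) :
    maclaurin (fun x => F x * G x) = maclaurin F * maclaurin G := by
  ext n
  rw [PowerSeries.coeff_mul, coeff_maclaurin, iteratedDeriv_fun_mul hF.contDiffAt hG.contDiffAt,
    Finset.Nat.sum_antidiagonal_eq_sum_range_succ
      fun i j => PowerSeries.coeff i (maclaurin F) * PowerSeries.coeff j (maclaurin G),
    Finset.sum_div]
  refine Finset.sum_congr rfl fun i hi => ?_
  have hin : i ≤ n := Nat.lt_succ_iff.1 (Finset.mem_range.1 hi)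
  rw [coeff_maclaurin, coeff_maclaurin, Nat.cast_choose ℝ hin]
  have h1 : (n.factorial : ℝ) ≠ 0 := by positivity
  have h2 : (i.factorial : ℝ) ≠ 0 := by positivity
  have h3 : ((n - i).factorial : ℝ) ≠ 0 := by positivity
  field_simp

theorem maclaurin_const (c : ℝ) : maclaurin (fun _ => c) = PowerSeries.C c := by
  ext n
  rw [coeff_maclaurin, PowerSeries.coeff_C, iteratedDeriv_const]
  split_ifs with h <;> simp [h]

theorem maclaurin_deriv (F : ℝ → ℝ) :
    maclaurin (deriv F) = PowerSeries.derivative ℝ (maclaurin F) := by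
  ext n
  rw [PowerSeries.coeff_derivative, coeff_maclaurin, coeff_maclaurin, ← iteratedDeriv_succ',
    Nat.factorial_succ]
  push_cast
  have h1 : (n.factorial : ℝ) ≠ 0 := by positivity
  field_simp

theorem maclaurin_id : maclaurin (fun x => x) = PowerSeries.X := by
  ext n
  rw [coeff_maclaurin, PowerSeries.coeff_X]
  rcases n with _ | _ | n
  · simp
  · simp [iteratedDeriv_succ]
  · have h : deriv (fun x : ℝ => x) = fun _ => 1 := by
      ext x
      simp
    rw [iteratedDeriv_succ', h, iteratedDeriv_const]
    simp

theorem analyticAt_Phat {h : ℝ → ℝ} {x : ℝ} (hh : AnalyticAt ℝ h x) (k : ℕ) :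
    AnalyticAt ℝ (Phat h k) x := by
  induction k with
  | zero => exact analyticAt_id
  | succ k ih =>
    exact (ih.deriv.mul (analyticAt_const.add hh)).sub ((analyticAt_const.mul ih).mul hh.deriv)

theorem analyticAt_Qhat {f g : ℝ → ℝ} {x : ℝ} (hf : AnalyticAt ℝ f x) (hg : AnalyticAt ℝ g x)
    (k : ℕ) : AnalyticAt ℝ (Qhat f g k) x := by
  induction k with
  | zero => exact hg
  | succ k ih => exact ih.deriv.sub ((analyticAt_const.mul hf).mul ih)

theorem maclaurin_Phat_succ {h : ℝ → ℝ} (hh : AnalyticAt ℝ h 0) (k : ℕ) :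
    maclaurin (Phat h (k + 1)) =
      PowerSeries.derivative ℝ (maclaurin (Phat h k)) * (1 + maclaurin h)
        - PowerSeries.C (2 * ((k : ℝ) + 1) - 1) * maclaurin (Phat h k)
          * PowerSeries.derivative ℝ (maclaurin h) := by
  have hP := analyticAt_Phat hh k
  have hc : AnalyticAt ℝ (fun _ : ℝ => 2 * ((k : ℝ) + 1) - 1) 0 := analyticAt_const
  have h1 : AnalyticAt ℝ (fun _ : ℝ => (1 : ℝ)) 0 := analyticAt_const
  rw [Phat, maclaurin_sub (hP.deriv.fun_mul (h1.fun_add hh)) ((hc.fun_mul hP).fun_mul hh.deriv),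
    maclaurin_mul hP.deriv (h1.fun_add hh), maclaurin_mul (hc.fun_mul hP) hh.deriv, maclaurin_mul hc hP,
    maclaurin_add h1 hh, maclaurin_const, maclaurin_const, maclaurin_deriv, maclaurin_deriv, map_one]

theorem maclaurin_Qhat_succ {f g : ℝ → ℝ} (hf : AnalyticAt ℝ f 0) (hg : AnalyticAt ℝ g 0) (k : ℕ) :
    maclaurin (Qhat f g (k + 1)) =
      PowerSeries.derivative ℝ (maclaurin (Qhat f g k))
        - PowerSeries.C (((k : ℝ) + 1) - 2) * maclaurin f * maclaurin (Qhat f g k) := by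
  have hQ := analyticAt_Qhat hf hg k
  have hc : AnalyticAt ℝ (fun _ : ℝ => ((k : ℝ) + 1) - 2) 0 := analyticAt_const
  rw [Qhat, maclaurin_sub hQ.deriv ((hc.fun_mul hf).fun_mul hQ), maclaurin_mul (hc.fun_mul hf) hQ,
    maclaurin_mul hc hf, maclaurin_const, maclaurin_deriv]

/-- Truncated products depend on the truncations of the factors only. -/
theorem truncAt_mul_congr {n : ℕ} {A B C D : PowerSeries ℝ} (h : truncAt n A = truncAt n C)
    (h' : truncAt n B = truncAt n D) : truncAt n (A * B) = truncAt n (C * D) := by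
  unfold truncAt at *
  rw [← PowerSeries.trunc_trunc_mul_trunc, h, h', PowerSeries.trunc_trunc_mul_trunc]

theorem truncAt_sub (n : ℕ) (A B : PowerSeries ℝ) :
    truncAt n (A - B) = truncAt n A - truncAt n B :=
  PowerSeries.trunc_sub _ _ _

theorem truncAt_truncAt {m n : ℕ} (h : n ≤ m) (A : PowerSeries ℝ) :
    truncAt n (truncAt m A : PowerSeries ℝ) = truncAt n A :=
  PowerSeries.trunc_trunc_of_le _ (by omega)

theorem truncAt_add_truncAt (n : ℕ) (A B : PowerSeries ℝ) :
    truncAt n (A + (truncAt n B : PowerSeries ℝ)) = truncAt n (A + B) := by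
  unfold truncAt
  rw [map_add, map_add, PowerSeries.trunc_trunc]

theorem derivative_truncAt (n : ℕ) (A : PowerSeries ℝ) :
    (truncAt (n + 1) A).derivative = truncAt n (PowerSeries.derivative ℝ A) :=
  (PowerSeries.trunc_derivative _ _).symm

/-- With M - k = n + 1, the previous polynomial is exact to order n + 1, hence its derivative to
order n. Every other factor is needed only to order n. -/
theorem PhatTrunc_eq {h : ℝ → ℝ} (hh : AnalyticAt ℝ h 0) (M k : ℕ) (hk : k ≤ M) :
    PhatTrunc (maclaurin h) M k = truncAt (M - k) (maclaurin (Phat h k)) := by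
  induction k with
  | zero => simp only [PhatTrunc, Phat, maclaurin_id, Nat.sub_zero]
  | succ k ih =>
    obtain ⟨n, hn⟩ : ∃ n, M - k = n + 1 := ⟨M - k - 1, by omega⟩
    have hn' : M - (k + 1) = n := by omega
    rw [PhatTrunc]
    simp only [ih (by omega), hn, hn', derivative_truncAt]
    push_cast
    rw [maclaurin_Phat_succ hh, truncAt_sub, truncAt_sub]
    congr 1
    · exact truncAt_mul_congr (truncAt_truncAt le_rfl _) (truncAt_add_truncAt _ _ _)
    · refine truncAt_mul_congr (truncAt_mul_congr ?_ (truncAt_truncAt (Nat.le_succ n) _))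
        (truncAt_truncAt le_rfl _)
      simp

theorem QhatTrunc_eq {f g : ℝ → ℝ} (hf : AnalyticAt ℝ f 0) (hg : AnalyticAt ℝ g 0) (M k : ℕ)
    (hk : k ≤ M) :
    QhatTrunc (maclaurin f) (maclaurin g) M k = truncAt (M - k) (maclaurin (Qhat f g k)) := by
  induction k with
  | zero => simp only [QhatTrunc, Qhat, Nat.sub_zero]
  | succ k ih =>
    obtain ⟨n, hn⟩ : ∃ n, M - k = n + 1 := ⟨M - k - 1, by omega⟩
    have hn' : M - (k + 1) = n := by omega
    rw [QhatTrunc]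
    simp only [ih (by omega), hn, hn', derivative_truncAt]
    push_cast
    rw [maclaurin_Qhat_succ hf hg, truncAt_sub, truncAt_sub]
    congr 1
    · exact truncAt_truncAt le_rfl _
    · refine truncAt_mul_congr (truncAt_mul_congr ?_ (truncAt_truncAt le_rfl _))
        (truncAt_truncAt (Nat.le_succ n) _)
      simp

theorem eval_zero_truncAt_maclaurin (n : ℕ) (F : ℝ → ℝ) :
    (truncAt n (maclaurin F)).eval 0 = F 0 := by
  rw [← Polynomial.coeff_zero_eq_eval_zero, truncAt, PowerSeries.coeff_trunc, if_pos n.succ_pos,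
    coeff_maclaurin]
  simp

/-! ### Periodic orbits and their periods in the energy coordinate -/

/-- The solution of `Θ' = 1 / w(Θ)`, `Θ(0) = θ₀`, on the circle, for a speed `w` bounded below. -/
theorem exists_circle_flow {w : ℝ → ℝ} (hw : Continuous w)
    (hper : Function.Periodic w (2 * Real.pi)) (hpos : ∀ s, 1 / 2 ≤ w s) (θ₀ : ℝ) :
    ∃ Θ : ℝ → ℝ, Θ 0 = θ₀ ∧ StrictMono Θ ∧ (∀ t, HasDerivAt Θ (w (Θ t))⁻¹ t) ∧
      ∀ t, Θ (t + ∫ s in (0 : ℝ)..2 * Real.pi, w s) = Θ t + 2 * Real.pi := by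
  -- τ is the time needed to reach the angle θ; the bound `1 / 2 ≤ w` makes it an increasing
  -- bijection of the line, and Θ is its inverse.
  set τ : ℝ → ℝ := fun θ => ∫ s in θ₀..θ, w s with hτ
  have hi : ∀ a b, IntervalIntegrable w MeasureTheory.volume a b :=
    fun a b => hw.intervalIntegrable a b
  have hτd : ∀ θ, HasDerivAt τ (w θ) θ := fun θ =>
    intervalIntegral.integral_hasDerivAt_right (hi _ _) (hw.stronglyMeasurableAtFilter _ _)
      hw.continuousAt
  have hsub : ∀ a b, a ≤ b → (b - a) / 2 ≤ τ b - τ a := by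
    intro a b hab
    have h1 : τ b - τ a = ∫ s in a..b, w s :=
      intervalIntegral.integral_interval_sub_left (hi _ _) (hi _ _)
    have h2 : ∫ s in a..b, (1 / 2 : ℝ) ≤ ∫ s in a..b, w s :=
      intervalIntegral.integral_mono_on hab (by simp) (hi _ _) fun s _ => hpos s
    rw [intervalIntegral.integral_const, smul_eq_mul] at h2
    linarith
  have hmono : StrictMono τ := by
    intro a b hab
    have := hsub a b hab.le
    linarith
  have hτc : Continuous τ := continuous_iff_continuousAt.2 fun θ => (hτd θ).continuousAt
  have hτ0 : τ θ₀ = 0 := intervalIntegral.integral_same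
  have hsurj : Function.Surjective τ := by
    refine hτc.surjective ?_ ?_
    · refine Filter.tendsto_atTop_mono' _ ?_ ((Filter.tendsto_atTop_add_const_right _
        (-θ₀) Filter.tendsto_id).atTop_div_const (r := 2) two_pos)
      filter_upwards [Filter.eventually_ge_atTop θ₀] with θ hθ
      have := hsub θ₀ θ hθ
      simp only [id]
      linarith
    · refine Filter.tendsto_atBot_mono' _ ?_ ((Filter.tendsto_atBot_add_const_right _
        (-θ₀) Filter.tendsto_id).atBot_div_const (r := 2) two_pos)
      filter_upwards [Filter.eventually_le_atBot θ₀] with θ hθ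
      have := hsub θ θ₀ hθ
      simp only [id]
      linarith
  set e := hmono.orderIsoOfSurjective τ hsurj with he
  have heτ : ∀ θ, e θ = τ θ := fun _ => rfl
  have hτs : ∀ t, τ (e.symm t) = t := fun t => e.apply_symm_apply t
  have hsτ : ∀ θ, e.symm (τ θ) = θ := fun θ => e.symm_apply_apply θ
  refine ⟨e.symm, ?_, e.symm.strictMono, fun t => ?_, fun t => ?_⟩
  · rw [← hτ0, hsτ]
  · exact (hτd (e.symm t)).of_local_left_inverse e.symm.continuous.continuousAt
      (by linarith [hpos (e.symm t)]) (Filter.Eventually.of_forall hτs)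
  · have h1 : τ (e.symm t + 2 * Real.pi) = t + ∫ s in (0 : ℝ)..2 * Real.pi, w s := by
      have h2 : τ (e.symm t + 2 * Real.pi) - τ (e.symm t)
          = ∫ s in (e.symm t)..(e.symm t + 2 * Real.pi), w s :=
        intervalIntegral.integral_interval_sub_left (hi _ _) (hi _ _)
      rw [hper.intervalIntegral_add_eq (e.symm t) 0, zero_add, hτs] at h2
      linarith
    rw [← h1, hsτ]

/-- In the coordinate `ξ`, with `x = a(ξ)` and `ξ² / 2` the potential energy, the system
`ẋ = y`, `ẏ = -g(x) - f(x) y²` has the energy `(ξ² + η²) / 2` with `η = -e^{F(x)} y`, where `F` is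
a primitive of `f`; and `1 + h(ξ)` is the derivative of `∫ e^F dx` with respect to `ξ`. -/
structure IsEnergyChart (f g F a h : ℝ → ℝ) (U : Set ℝ) (r : ℝ) : Prop where
  mem : ∀ ξ, |ξ| < r → a ξ ∈ U
  hasDerivAt_primitive : ∀ ξ, |ξ| < r → HasDerivAt F (f (a ξ)) (a ξ)
  hasDerivAt : ∀ ξ, |ξ| < r → HasDerivAt a (Real.exp (-F (a ξ)) * (1 + h ξ)) ξ
  force : ∀ ξ, |ξ| < r → g (a ξ) * Real.exp (F (a ξ)) * (1 + h ξ) = ξ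
  half_le : ∀ ξ, |ξ| < r → 1 / 2 ≤ 1 + h ξ
  continuousAt : ∀ ξ, |ξ| < r → ContinuousAt h ξ

/-- The derivative of `a` is positive. Injectivity lets a return of the orbit be read on the circle,
and keeps `(a A, 0)` off the equilibrium. -/
theorem IsEnergyChart.injOn {f g F a h : ℝ → ℝ} {U : Set ℝ} {r : ℝ}
    (H : IsEnergyChart f g F a h U r) : Set.InjOn a (Set.Ioo (-r) r) := by
  refine (strictMonoOn_of_deriv_pos (convex_Ioo _ _) ?_ ?_).injOn
  · exact fun ξ hξ => (H.hasDerivAt ξ (abs_lt.2 hξ)).continuousAt.continuousWithinAt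
  · intro ξ hξ
    rw [interior_Ioo] at hξ
    rw [(H.hasDerivAt ξ (abs_lt.2 hξ)).deriv]
    have := H.half_le ξ (abs_lt.2 hξ)
    exact mul_pos (Real.exp_pos _) (by linarith)

theorem abs_mul_cos_lt {A r : ℝ} (hA : 0 < A) (hAr : A < r) (s : ℝ) : |A * Real.cos s| < r := by
  rw [abs_mul, abs_of_pos hA]
  have := Real.abs_cos_le_one s
  nlinarith

theorem IsEnergyChart.continuous_speed {f g F a h : ℝ → ℝ} {U : Set ℝ} {r : ℝ}
    (H : IsEnergyChart f g F a h U r) {A : ℝ} (hA : 0 < A) (hAr : A < r) :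
    Continuous fun s => 1 + h (A * Real.cos s) := by
  refine continuous_const.add (continuous_iff_continuousAt.2 fun s => ?_)
  exact ContinuousAt.comp (f := fun s => A * Real.cos s) (H.continuousAt _ (abs_mul_cos_lt hA hAr s))
    (by fun_prop)

/-- The orbit of energy `A² / 2` is periodic; its minimal period is an integral of `1 + h`. -/
theorem IsEnergyChart.exists_periodic {f g F a h : ℝ → ℝ} {U : Set ℝ} {r : ℝ}
    (H : IsEnergyChart f g F a h U r) {A : ℝ} (hA : 0 < A) (hAr : A < r) (θ₀ : ℝ) :
    ∃ γ : ℝ → ℝ × ℝ,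
      IsPeriodicSolution (lienardField f g) {z : ℝ × ℝ | z.1 ∈ U}
        (∫ s in (0 : ℝ)..2 * Real.pi, (1 + h (A * Real.cos s))) γ ∧
      γ 0 = (a (A * Real.cos θ₀),
        -(Real.exp (-F (a (A * Real.cos θ₀))) * (A * Real.sin θ₀))) := by
  have hlt : ∀ s, |A * Real.cos s| < r := abs_mul_cos_lt hA hAr
  have hc := H.continuous_speed hA hAr
  have hhalf : ∀ s, 1 / 2 ≤ 1 + h (A * Real.cos s) := fun s => H.half_le _ (hlt s)
  obtain ⟨Θ, hΘ0, hΘm, hΘd, hΘT⟩ := exists_circle_flow hc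
    (fun s => by simp only [Real.cos_add_two_pi]) hhalf θ₀
  -- The circle ξ = A cos Θ, η = A sin Θ pulled back by x = a(ξ), y = -e^{-F} η.
  refine ⟨fun t => (a (A * Real.cos (Θ t)),
    -(Real.exp (-F (a (A * Real.cos (Θ t)))) * (A * Real.sin (Θ t)))), ?_, by simp only [hΘ0]⟩
  refine ⟨fun t => H.mem _ (hlt _), fun t => ?_, ?_, fun t => ?_, fun s hs0 hsT hper => ?_⟩
  · have hw : 1 + h (A * Real.cos (Θ t)) ≠ 0 := by
      have := hhalf (Θ t)
      linarith
    have hξ : HasDerivAt (fun t => A * Real.cos (Θ t))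
        (A * (-Real.sin (Θ t) * (1 + h (A * Real.cos (Θ t)))⁻¹)) t :=
      ((hΘd t).cos).const_mul A
    have hη : HasDerivAt (fun t => A * Real.sin (Θ t))
        (A * (Real.cos (Θ t) * (1 + h (A * Real.cos (Θ t)))⁻¹)) t :=
      ((hΘd t).sin).const_mul A
    have ha : HasDerivAt (fun t => a (A * Real.cos (Θ t))) _ t :=
      HasDerivAt.comp t (H.hasDerivAt _ (hlt (Θ t))) hξ
    have hF : HasDerivAt (fun t => F (a (A * Real.cos (Θ t)))) _ t :=
      HasDerivAt.comp t (H.hasDerivAt_primitive _ (hlt (Θ t))) ha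
    have hy := (hF.fun_neg.exp.fun_mul hη).fun_neg
    refine (ha.prodMk hy).congr_deriv ?_
    have hforce := H.force _ (hlt (Θ t))
    have hE : Real.exp (-F (a (A * Real.cos (Θ t)))) * Real.exp (F (a (A * Real.cos (Θ t)))) = 1 := by
      rw [← Real.exp_add]
      simp
    simp only [lienardField]
    generalize Real.exp (-F (a (A * Real.cos (Θ t)))) = e at *
    generalize Real.exp (F (a (A * Real.cos (Θ t)))) = e' at *
    generalize g (a (A * Real.cos (Θ t))) = G at *
    generalize f (a (A * Real.cos (Θ t))) = f' at *
    generalize 1 + h (A * Real.cos (Θ t)) = w at *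
    ext
    · simp only
      field_simp
    · simp only
      have hG : G = e * (A * Real.cos (Θ t)) * w⁻¹ := by
        rw [← hforce]
        field_simp
        linear_combination (-G) * hE
      rw [hG]
      field_simp
      ring
  · have h2 : ∫ s in (0 : ℝ)..2 * Real.pi, (1 / 2 : ℝ)
        ≤ ∫ s in (0 : ℝ)..2 * Real.pi, (1 + h (A * Real.cos s)) :=
      intervalIntegral.integral_mono_on (by positivity) (by simp) (hc.intervalIntegrable _ _)
        fun s _ => hhalf s
    rw [intervalIntegral.integral_const, smul_eq_mul] at h2
    have := Real.pi_pos
    linarith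
  · simp only [hΘT, Real.cos_add_two_pi, Real.sin_add_two_pi]
  -- A smaller period s would make Θ s - Θ 0 a multiple of 2π, yet it lies strictly between 0 and
  -- 2π.
  · have h0 := hper 0
    rw [zero_add, Prod.mk.injEq] at h0
    have hcos' := H.injOn (abs_lt.1 (hlt _)) (abs_lt.1 (hlt _)) h0.1
    have hcos : Real.cos (Θ s) = Real.cos (Θ 0) := mul_left_cancel₀ hA.ne' hcos'
    have hsin : Real.sin (Θ s) = Real.sin (Θ 0) := by
      have h1 := neg_injective h0.2
      rw [h0.1] at h1
      exact mul_left_cancel₀ hA.ne' (mul_left_cancel₀ (Real.exp_pos _).ne' h1)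
    obtain ⟨k, hk⟩ := Real.Angle.angle_eq_iff_two_pi_dvd_sub.1 (Real.Angle.cos_sin_inj hcos hsin)
    have h1 : Θ 0 < Θ s := hΘm hs0
    have h2 : Θ s < Θ 0 + 2 * Real.pi := by
      rw [← hΘT 0, zero_add]
      exact hΘm hsT
    have hpi := Real.two_pi_pos
    have h3 : (0 : ℝ) < k := by
      by_contra hcon
      nlinarith
    have h4 : (k : ℝ) < 1 := by
      by_contra hcon
      nlinarith
    have h3' : 0 < k := by exact_mod_cast h3
    have h4' : k < 1 := by exact_mod_cast h4
    omega

/-! ### The conditions P̂ₖ(0) = Q̂ₖ(0) as equality of two germs -/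

/-- The germ at `0` of a change of coordinate `x = a(ξ)` in which `ξ² / 2` is the potential energy
of `ẍ + f(x) ẋ² + g(x) = 0`; here `F` is a primitive of `f`. -/
structure IsEnergyGerm (g F a h : ℝ → ℝ) : Prop where
  analyticAt : AnalyticAt ℝ a 0
  analyticAt_speed : AnalyticAt ℝ h 0
  map_zero : a 0 = 0
  speed_zero : h 0 = 0
  hasDerivAt : ∀ᶠ ξ in 𝓝 (0 : ℝ), HasDerivAt a (Real.exp (-F (a ξ)) * (1 + h ξ)) ξ
  force : ∀ᶠ ξ in 𝓝 (0 : ℝ), g (a ξ) * Real.exp (F (a ξ)) * (1 + h ξ) = ξ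

theorem AnalyticAt.tendsto_zero {F : ℝ → ℝ} (hF : AnalyticAt ℝ F 0) (h0 : F 0 = 0) :
    Filter.Tendsto F (𝓝 0) (𝓝 0) := by
  simpa [ContinuousAt, h0] using hF.continuousAt

theorem AnalyticAt.eventuallyEq_of_deriv_eq {F G : ℝ → ℝ} (hF : AnalyticAt ℝ F 0)
    (hG : AnalyticAt ℝ G 0) (h0 : F 0 = G 0) (h : deriv F =ᶠ[𝓝 0] deriv G) : F =ᶠ[𝓝 0] G := by
  refine hF.eventuallyEq_of_iteratedDeriv_eq hG fun n => ?_
  rcases n with _ | n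
  · simpa using h0
  · rw [iteratedDeriv_succ', iteratedDeriv_succ']
    exact h.iteratedDeriv_eq n

/-- Here d/du = e^{-F} d/dx, and differentiating Q̂ₖ e^{(1-k)F} gives e^{-kF} (Q̂ₖ' - (k-1) f Q̂ₖ):
the recursion is made for this. -/
theorem iteratedDeriv_force_eq_Qhat {f g F b : ℝ → ℝ} (hf : AnalyticAt ℝ f 0)
    (hg : AnalyticAt ℝ g 0) (hF : ∀ᶠ x in 𝓝 (0 : ℝ), HasDerivAt F (f x) x)
    (hb : AnalyticAt ℝ b 0) (hb0 : b 0 = 0)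
    (hbd : ∀ᶠ u in 𝓝 (0 : ℝ), HasDerivAt b (Real.exp (-F (b u))) u) (k : ℕ) :
    iteratedDeriv k (fun u => g (b u) * Real.exp (F (b u))) =ᶠ[𝓝 0]
      fun u => Qhat f g k (b u) * Real.exp ((1 - (k : ℝ)) * F (b u)) := by
  induction k with
  | zero => simp [Qhat]
  | succ k ih =>
    rw [iteratedDeriv_succ]
    refine ih.deriv.trans ?_
    have ht := hb.tendsto_zero hb0
    filter_upwards [hbd, ht.eventually hF,
      ht.eventually (analyticAt_Qhat hf hg k).eventually_hasDerivAt] with u h1 h2 h3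
    have h4 : HasDerivAt (fun u => Qhat f g k (b u)) _ u := HasDerivAt.comp u h3 h1
    have h5 : HasDerivAt (fun u => F (b u)) _ u := HasDerivAt.comp u h2 h1
    rw [(h4.fun_mul ((h5.const_mul (1 - (k : ℝ))).exp)).deriv]
    have h6 : Real.exp ((1 - ((k + 1 : ℕ) : ℝ)) * F (b u))
        = Real.exp ((1 - (k : ℝ)) * F (b u)) * Real.exp (-F (b u)) := by
      rw [← Real.exp_add]
      congr 1
      push_cast
      ring
    rw [h6, Qhat]
    ring

/-- Here d/du = (1 + h)⁻¹ d/dξ; the quotient rule applied to P̂ₖ/(1 + h)^{2k+1} produces the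
numerator P̂ₖ' (1 + h) - (2k+1) P̂ₖ h'. -/
theorem iteratedDeriv_div_eq_Phat {h ψ : ℝ → ℝ} (hh : AnalyticAt ℝ h 0) (hh0 : h 0 = 0)
    (hψ : AnalyticAt ℝ ψ 0) (hψ0 : ψ 0 = 0)
    (hψd : ∀ᶠ u in 𝓝 (0 : ℝ), HasDerivAt ψ (1 + h (ψ u))⁻¹ u) (k : ℕ) :
    iteratedDeriv k (fun u => ψ u / (1 + h (ψ u))) =ᶠ[𝓝 0]
      fun u => Phat h k (ψ u) / (1 + h (ψ u)) ^ (2 * k + 1) := by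
  induction k with
  | zero => simp [Phat]
  | succ k ih =>
    rw [iteratedDeriv_succ]
    refine ih.deriv.trans ?_
    have ht := hψ.tendsto_zero hψ0
    have hne : ∀ᶠ ξ in 𝓝 (0 : ℝ), 1 + h ξ ≠ 0 :=
      (continuousAt_const.add hh.continuousAt).eventually_ne (by simp [hh0])
    filter_upwards [hψd, ht.eventually hh.eventually_hasDerivAt, ht.eventually hne,
      ht.eventually (analyticAt_Phat hh k).eventually_hasDerivAt] with u h1 h2 h3 h4
    have h5 : HasDerivAt (fun u => Phat h k (ψ u)) _ u := HasDerivAt.comp u h4 h1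
    have h6 : HasDerivAt (fun u => h (ψ u)) _ u := HasDerivAt.comp u h2 h1
    rw [(h5.fun_div ((h6.const_add 1).fun_pow (2 * k + 1)) (pow_ne_zero _ h3)).deriv]
    simp only [Phat]
    generalize Phat h k (ψ u) = p at *
    generalize 1 + h (ψ u) = w at *
    have e1 : 2 * k + 1 - 1 = 2 * k := by omega
    have e2 : 2 * (k + 1) + 1 = 2 * k + 3 := by ring
    rw [e1, e2]
    push_cast
    field_simp
    ring

theorem forall_Phat_eq_Qhat_iff {f g F h : ℝ → ℝ} (hf : AnalyticAt ℝ f 0) (hg : AnalyticAt ℝ g 0)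
    (hF : AnalyticAt ℝ F 0) (hF0 : F 0 = 0) (hFd : ∀ᶠ x in 𝓝 (0 : ℝ), HasDerivAt F (f x) x)
    (hh : AnalyticAt ℝ h 0) (hh0 : h 0 = 0) :
    (∀ k, Phat h k 0 = Qhat f g k 0) ↔ ∃ a, IsEnergyGerm g F a h := by
  -- Both coordinates are compared with u: φ is u in terms of x, with inverse b; υ is u in terms of
  -- ξ, with inverse ψ.
  obtain ⟨φ, hφ, hφ0, hφd⟩ :=
    AnalyticAt.exists_primitive (f := fun x => Real.exp (F x)) hF.rexp'
  obtain ⟨b, hb, hb0, -, hbφ, hφb⟩ :=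
    hφ.exists_local_inverse hφ0 (by simp [hφd.self_of_nhds.deriv, hF0])
  obtain ⟨υ, hυ, hυ0, hυd⟩ :=
    AnalyticAt.exists_primitive (f := fun x => 1 + h x) (analyticAt_const.fun_add hh)
  obtain ⟨ψ, hψ, hψ0, -, hψυ, hυψ⟩ :=
    hυ.exists_local_inverse hυ0 (by simp [hυd.self_of_nhds.deriv, hh0])
  have hne : ∀ᶠ ξ in 𝓝 (0 : ℝ), 1 + h ξ ≠ 0 :=
    (continuousAt_const.add hh.continuousAt).eventually_ne (by simp [hh0])
  have htb := hb.tendsto_zero hb0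
  have htψ := hψ.tendsto_zero hψ0
  have htυ := hυ.tendsto_zero hυ0
  have hbd : ∀ᶠ u in 𝓝 (0 : ℝ), HasDerivAt b (Real.exp (-F (b u))) u := by
    filter_upwards [hb.eventually_analyticAt, htb.eventually hφd, hφb.eventually_nhds]
      with u h1 h2 h3
    rw [Real.exp_neg]
    exact h2.of_local_left_inverse h1.continuousAt (Real.exp_pos _).ne' h3
  have hψd : ∀ᶠ u in 𝓝 (0 : ℝ), HasDerivAt ψ (1 + h (ψ u))⁻¹ u := by
    filter_upwards [hψ.eventually_analyticAt, htψ.eventually hυd, hυψ.eventually_nhds,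
      htψ.eventually hne] with u h1 h2 h3 h4
    exact h2.of_local_left_inverse h1.continuousAt h4 h3
  have hgb : AnalyticAt ℝ (fun u => g (b u) * Real.exp (F (b u))) 0 :=
    (hg.fun_comp_of_eq hb hb0).fun_mul (hF.fun_comp_of_eq hb hb0).rexp'
  have hψh : AnalyticAt ℝ (fun u => ψ u / (1 + h (ψ u))) 0 :=
    hψ.fun_div (analyticAt_const.fun_add (hh.fun_comp_of_eq hψ hψ0)) (by simp [hψ0, hh0])
  have hP : ∀ k, iteratedDeriv k (fun u => ψ u / (1 + h (ψ u))) 0 = Phat h k 0 := fun k => by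
    rw [(iteratedDeriv_div_eq_Phat hh hh0 hψ hψ0 hψd k).self_of_nhds]
    simp [hψ0, hh0]
  have hQ : ∀ k, iteratedDeriv k (fun u => g (b u) * Real.exp (F (b u))) 0 = Qhat f g k 0 :=
    fun k => by
      rw [(iteratedDeriv_force_eq_Qhat hf hg hFd hb hb0 hbd k).self_of_nhds]
      simp [hb0, hF0]
  simp only [← hP, ← hQ]
  constructor
  · intro hk
    have hG := hψh.eventuallyEq_of_iteratedDeriv_eq hgb hk
    -- Passing from ξ to x through u.
    refine ⟨fun ξ => b (υ ξ), hb.fun_comp_of_eq hυ hυ0, hh, by simp [hυ0, hb0], hh0, ?_, ?_⟩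
    · filter_upwards [htυ.eventually hbd, hυd] with ξ h1 h2
      exact HasDerivAt.comp ξ h1 h2
    · filter_upwards [htυ.eventually hG, hψυ, hne] with ξ h1 h2 h3
      rw [h2] at h1
      rw [← h1, div_mul_cancel₀ _ h3]
  · rintro ⟨a, ha⟩ k
    have hta := ha.analyticAt.tendsto_zero ha.map_zero
    -- Any energy germ is necessarily b ∘ υ, since φ ∘ a and υ have the same derivative and both
    -- vanish at 0.
    have hφa : (fun ξ => φ (a ξ)) =ᶠ[𝓝 0] υ := by
      refine (hφ.fun_comp_of_eq ha.analyticAt ha.map_zero).eventuallyEq_of_deriv_eq hυ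
        (by simp [ha.map_zero, hφ0, hυ0]) ?_
      filter_upwards [hta.eventually hφd, ha.hasDerivAt, hυd] with ξ h1 h2 h3
      have h4 : HasDerivAt (fun ξ => φ (a ξ)) _ ξ := HasDerivAt.comp ξ h1 h2
      rw [h4.deriv, h3.deriv,
        ← mul_assoc, ← Real.exp_add]
      simp
    have hab : ∀ᶠ u in 𝓝 (0 : ℝ), a (ψ u) = b u := by
      filter_upwards [htψ.eventually hφa, htψ.eventually (hta.eventually hbφ), hυψ] with u h1 h2 h3
      rw [← h2, h1, h3]
    refine Filter.EventuallyEq.iteratedDeriv_eq k ?_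
    filter_upwards [hab, htψ.eventually ha.force, htψ.eventually hne] with u h1 h2 h3
    rw [h1] at h2
    rw [div_eq_iff h3, h2]

/-! ### Existence of the energy coordinate -/

theorem AnalyticAt.dslope_zero {G : ℝ → ℝ} (hG : AnalyticAt ℝ G 0) :
    AnalyticAt ℝ (dslope G 0) 0 := by
  obtain ⟨p, hp⟩ := hG
  exact ⟨_, hp.has_fpower_series_dslope_fslope⟩

theorem eq_mul_dslope_zero {G : ℝ → ℝ} (h0 : G 0 = 0) (x : ℝ) : G x = x * dslope G 0 x := by
  have := sub_smul_dslope G 0 x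
  simpa [h0] using this.symm

/-- The potential is W = x² w with w(0) = 1/2, so ξ = x √(2w) is an analytic coordinate with ξ²/2 =
W, and `a` is its inverse. -/
theorem exists_isEnergyGerm {g F : ℝ → ℝ} (hg : AnalyticAt ℝ g 0) (hg0 : g 0 = 0)
    (hg1 : deriv g 0 = 1) (hF : AnalyticAt ℝ F 0) (hF0 : F 0 = 0) :
    ∃ a h, IsEnergyGerm g F a h := by
  have hgF : AnalyticAt ℝ (fun x => g x * Real.exp (2 * F x)) 0 :=
    hg.fun_mul (analyticAt_const.fun_mul hF).rexp'
  obtain ⟨W, hW, hW0, hWd⟩ := hgF.exists_primitive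
  set w₁ := dslope W 0 with hw₁
  have hw₁a : AnalyticAt ℝ w₁ 0 := hW.dslope_zero
  have hw₁0 : w₁ 0 = 0 := by
    rw [hw₁, dslope_same, hWd.self_of_nhds.deriv, hg0, zero_mul]
  set w := dslope w₁ 0 with hw
  have hwa : AnalyticAt ℝ w 0 := hw₁a.dslope_zero
  have hWw : ∀ x, W x = x ^ 2 * w x := fun x => by
    rw [eq_mul_dslope_zero hW0 x, ← hw₁, eq_mul_dslope_zero hw₁0 x, ← hw]
    ring
  -- Both sides of W' = g e^{2F} are divisible by x; the quotients agree off 0, hence at 0 by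
  -- continuity.
  have hw0 : 2 * w 0 = 1 := by
    have h1 : ∀ᶠ x in 𝓝 (0 : ℝ), x * (dslope g 0 x * Real.exp (2 * F x))
        = x * (2 * w x + x * deriv w x) := by
      filter_upwards [hWd, hwa.eventually_hasDerivAt] with x h1 h2
      have h3 : HasDerivAt W _ x :=
        ((hasDerivAt_pow 2 x).fun_mul h2).congr_of_eventuallyEq (Filter.Eventually.of_forall hWw)
      rw [← mul_assoc, ← eq_mul_dslope_zero hg0 x, h1.unique h3]
      simp
      ring
    have h2 : (fun x => dslope g 0 x * Real.exp (2 * F x)) =ᶠ[𝓝[≠] 0]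
        fun x => 2 * w x + x * deriv w x := by
      filter_upwards [h1.filter_mono nhdsWithin_le_nhds, self_mem_nhdsWithin] with x h1 h2
      exact mul_left_cancel₀ h2 h1
    have h3 := (ContinuousAt.eventuallyEq_nhds_iff_eventuallyEq_nhdsNE
      (hg.dslope_zero.fun_mul (analyticAt_const.fun_mul hF).rexp').continuousAt
      ((analyticAt_const.fun_mul hwa).fun_add
        (analyticAt_id.fun_mul hwa.deriv)).continuousAt).1 h2
    have h4 := h3.self_of_nhds
    simp only [dslope_same, hg1, hF0] at h4
    simpa using h4.symm
  have h2w : AnalyticAt ℝ (fun x => 2 * w x) 0 := analyticAt_const.fun_mul hwa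
  -- The square root of 2w, written as exp(½ log) so that analyticity is immediate.
  have hρ : AnalyticAt ℝ (fun x => Real.exp (1 / 2 * Real.log (2 * w x))) 0 :=
    (analyticAt_const.fun_mul (h2w.log (by simp [hw0]))).rexp'
  set ρ : ℝ → ℝ := fun x => Real.exp (1 / 2 * Real.log (2 * w x)) with hρdef
  have hρ2 : ∀ᶠ x in 𝓝 (0 : ℝ), ρ x ^ 2 = 2 * w x := by
    filter_upwards [h2w.continuousAt.eventually (lt_mem_nhds (show 0 < 2 * w 0 by simp [hw0]))]
      with x hx
    rw [hρdef, ← Real.exp_nat_mul]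
    simp only [Nat.cast_ofNat]
    rw [← mul_assoc, mul_one_div_cancel two_ne_zero, one_mul, Real.exp_log hx]
  have hρ0 : ρ 0 = 1 := by simp [hρdef, hw0]
  set X : ℝ → ℝ := fun x => x * ρ x with hX
  have hXa : AnalyticAt ℝ X 0 := analyticAt_id.fun_mul hρ
  have hX0 : X 0 = 0 := by simp [hX]
  have hX1 : deriv X 0 = 1 := by
    rw [((hasDerivAt_id' (0 : ℝ)).fun_mul hρ.differentiableAt.hasDerivAt).deriv]
    simp [hρ0]
  have hXX : ∀ᶠ x in 𝓝 (0 : ℝ), X x * deriv X x = g x * Real.exp (2 * F x) := by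
    have h1 : ∀ᶠ x in 𝓝 (0 : ℝ), W x = X x ^ 2 / 2 := by
      filter_upwards [hρ2] with x hx
      rw [hWw, hX]
      simp only [mul_pow, hx]
      ring
    filter_upwards [h1.eventually_nhds, hWd, hXa.eventually_hasDerivAt] with x h2 h3 h4
    have h5 : HasDerivAt W _ x := ((h4.fun_pow 2).div_const 2).congr_of_eventuallyEq h2
    rw [h3.unique h5]
    simp
    ring
  obtain ⟨a, ha, ha0, ha1, haX, hXa'⟩ := hXa.exists_local_inverse hX0 hX1
  have hta := ha.tendsto_zero ha0
  have hFa : AnalyticAt ℝ (fun ξ => F (a ξ)) 0 := hF.fun_comp_of_eq ha ha0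
  -- Forced by 1 + h = du/dξ = e^F dx/dξ.
  refine ⟨a, fun ξ => Real.exp (F (a ξ)) * deriv a ξ - 1, ha,
    (hFa.rexp'.fun_mul ha.deriv).fun_sub analyticAt_const, ha0, by simp [ha0, hF0, ha1], ?_, ?_⟩
  · filter_upwards [ha.eventually_hasDerivAt] with ξ h1
    refine h1.congr_deriv ?_
    rw [add_sub_cancel, ← mul_assoc, ← Real.exp_add]
    simp
  · filter_upwards [hta.eventually hXX, hXa'.eventually_nhds, ha.eventually_hasDerivAt,
      hta.eventually hXa.eventually_hasDerivAt] with ξ h1 h2 h3 h4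
    have h5 : HasDerivAt (fun ξ => X (a ξ)) _ ξ := HasDerivAt.comp ξ h4 h3
    have h6 := h5.unique ((hasDerivAt_id' ξ).congr_of_eventuallyEq h2)
    rw [h2.self_of_nhds] at h1
    rw [add_sub_cancel]
    have h7 : Real.exp (2 * F (a ξ)) = Real.exp (F (a ξ)) * Real.exp (F (a ξ)) := by
      rw [← Real.exp_add]
      ring_nf
    rw [h7] at h1
    linear_combination (-deriv a ξ) * h1 + ξ * h6

/-! ### Uniqueness of orbits and of minimal periods -/

/-- Two solutions of `ż = X z`, defined for all times, with the same initial value coincide if `X`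
is continuously differentiable at the points they visit. -/
theorem eq_of_hasDerivAt_of_contDiffAt {X : ℝ × ℝ → ℝ × ℝ} {γ₁ γ₂ : ℝ → ℝ × ℝ}
    (hX : ∀ t, ContDiffAt ℝ 1 X (γ₁ t)) (h₁ : ∀ t, HasDerivAt γ₁ (X (γ₁ t)) t)
    (h₂ : ∀ t, HasDerivAt γ₂ (X (γ₂ t)) t) (h0 : γ₁ 0 = γ₂ 0) : γ₁ = γ₂ := by
  have hc₁ : Continuous γ₁ := continuous_iff_continuousAt.2 fun t => (h₁ t).continuousAt
  have hc₂ : Continuous γ₂ := continuous_iff_continuousAt.2 fun t => (h₂ t).continuousAt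
  -- The coincidence set is clopen in the connected line; openness is local Lipschitz uniqueness.
  have hcl : IsClosed {t | γ₁ t = γ₂ t} := isClosed_eq hc₁ hc₂
  have hop : IsOpen {t | γ₁ t = γ₂ t} := by
    rw [isOpen_iff_mem_nhds]
    intro t ht
    obtain ⟨K, s, hs, hK⟩ := (hX t).exists_lipschitzOnWith
    refine ODE_solution_unique_of_eventually (v := fun _ => X) (s := fun _ => s) (K := K)
      (Filter.Eventually.of_forall fun _ => hK) ?_ ?_ ht
    · filter_upwards [hc₁.continuousAt.eventually hs] with u hu using ⟨h₁ u, hu⟩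
    · rw [ht] at hs
      filter_upwards [hc₂.continuousAt.eventually hs] with u hu using ⟨h₂ u, hu⟩
  have huniv := IsClopen.eq_univ ⟨hcl, hop⟩ ⟨0, h0⟩
  ext1 t
  exact (huniv ▸ Set.mem_univ t : t ∈ {t | γ₁ t = γ₂ t})

theorem contDiffAt_lienardField {f g : ℝ → ℝ} {z : ℝ × ℝ} (hf : AnalyticAt ℝ f z.1)
    (hg : AnalyticAt ℝ g z.1) : ContDiffAt ℝ 1 (lienardField f g) z := by
  have hf' : ContDiffAt ℝ 1 (fun z : ℝ × ℝ => f z.1) z := hf.contDiffAt.comp z contDiffAt_fst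
  have hg' : ContDiffAt ℝ 1 (fun z : ℝ × ℝ => g z.1) z := hg.contDiffAt.comp z contDiffAt_fst
  exact contDiffAt_snd.prodMk (hg'.neg.sub (hf'.mul (contDiffAt_snd.pow 2)))

theorem IsPeriodicSolution.period_eq {X : ℝ × ℝ → ℝ × ℝ} {Ω : Set (ℝ × ℝ)} {T T' : ℝ}
    {γ : ℝ → ℝ × ℝ} (h : IsPeriodicSolution X Ω T γ) (h' : IsPeriodicSolution X Ω T' γ) :
    T = T' := by
  refine le_antisymm ?_ ?_
  · exact not_lt.1 fun hlt => h.minimal T' h'.period_pos hlt h'.periodic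
  · exact not_lt.1 fun hlt => h'.minimal T h.period_pos hlt h.periodic

theorem IsEnergyGerm.exists_isEnergyChart {f g F a h : ℝ → ℝ} {U : Set ℝ}
    (H : IsEnergyGerm g F a h) (hU : U ∈ 𝓝 (0 : ℝ))
    (hF : ∀ᶠ x in 𝓝 (0 : ℝ), HasDerivAt F (f x) x) :
    ∃ r > 0, IsEnergyChart f g F a h U r := by
  have hta := H.analyticAt.tendsto_zero H.map_zero
  have hhalf : ∀ᶠ ξ in 𝓝 (0 : ℝ), 1 / 2 < 1 + h ξ :=
    (continuousAt_const.add H.analyticAt_speed.continuousAt).eventually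
      (lt_mem_nhds (by simp [H.speed_zero]; norm_num))
  obtain ⟨r, hr, hball⟩ := Metric.eventually_nhds_iff.1 ((hta.eventually hU).and
    ((hta.eventually hF).and (H.hasDerivAt.and (H.force.and (hhalf.and
      H.analyticAt_speed.eventually_analyticAt)))))
  simp only [Real.dist_0_eq_abs] at hball
  exact ⟨r, hr, fun ξ hξ => (hball hξ).1, fun ξ hξ => (hball hξ).2.1,
    fun ξ hξ => (hball hξ).2.2.1, fun ξ hξ => (hball hξ).2.2.2.1,
    fun ξ hξ => (hball hξ).2.2.2.2.1.le, fun ξ hξ => (hball hξ).2.2.2.2.2.continuousAt⟩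

/-! ### Isochronicity and oddness of h -/

/-- The mean over the circle is unchanged by the half turn. -/
theorem integral_comp_neg_cos (h : ℝ → ℝ) (A : ℝ) :
    ∫ s in (0 : ℝ)..2 * Real.pi, h (-(A * Real.cos s))
      = ∫ s in (0 : ℝ)..2 * Real.pi, h (A * Real.cos s) := by
  have hper : Function.Periodic (fun s => h (A * Real.cos s)) (2 * Real.pi) := fun s => by
    simp only [Real.cos_add_two_pi]
  have h1 := hper.intervalIntegral_add_eq Real.pi 0
  have h2 := intervalIntegral.integral_comp_add_right (a := 0) (b := 2 * Real.pi)
    (fun s => h (A * Real.cos s)) Real.pi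
  rw [zero_add, add_comm (2 * Real.pi), h1, zero_add] at h2
  simpa only [Real.cos_add_pi, mul_neg] using h2

/-- An analytic function vanishing at `0` is odd near `0` if its means over the circles
`ξ = A cos s` do not depend on the small radius `A`. -/
theorem eventually_odd_of_integral_const {h : ℝ → ℝ} (hh : AnalyticAt ℝ h 0) (hh0 : h 0 = 0)
    {c r : ℝ} (hr : 0 < r)
    (hcont : ∀ A, 0 < A → A < r → Continuous fun s => h (A * Real.cos s))
    (hc : ∀ᶠ A in 𝓝[>] (0 : ℝ), ∫ s in (0 : ℝ)..2 * Real.pi, h (A * Real.cos s) = c) :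
    ∀ᶠ ξ in 𝓝 (0 : ℝ), h (-ξ) = -h ξ := by
  -- Twice the even part of h; its circle integrals are constant too, equal to 2c.
  set e : ℝ → ℝ := fun ξ => h ξ + h (-ξ) with he
  have hneg : AnalyticAt ℝ (fun ξ => h (-ξ)) 0 := hh.fun_comp_of_eq analyticAt_id.fun_neg (by simp)
  have hea : AnalyticAt ℝ e 0 := hh.fun_add hneg
  have he0 : e 0 = 0 := by simp [he, hh0]
  have hecont : ∀ A, 0 < A → A < r → Continuous fun s => e (A * Real.cos s) := by
    intro A hA hAr
    have h1 := (hcont A hA hAr).comp (continuous_id.add continuous_const : Continuous fun s => s + Real.pi)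
    refine (hcont A hA hAr).add (h1.congr fun s => ?_)
    simp [Real.cos_add_pi]
  have hlt : ∀ᶠ A in 𝓝[>] (0 : ℝ), A < r := nhdsWithin_le_nhds (gt_mem_nhds hr)
  have hpos : ∀ᶠ A in 𝓝[>] (0 : ℝ), 0 < A := self_mem_nhdsWithin
  have hec : ∀ᶠ A in 𝓝[>] (0 : ℝ), ∫ s in (0 : ℝ)..2 * Real.pi, e (A * Real.cos s) = 2 * c := by
    filter_upwards [hc, hlt, hpos] with A h1 h2 h3
    have h4 := hcont A h3 h2
    have h5 : Continuous fun s => h (-(A * Real.cos s)) := by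
      refine ((hecont A h3 h2).sub h4).congr fun s => ?_
      simp [he]
    rw [he, intervalIntegral.integral_add (h4.intervalIntegrable _ _) (h5.intervalIntegrable _ _),
      integral_comp_neg_cos, h1, two_mul]
  -- As A → 0 the integrals tend to 2π e(0) = 0.
  have hc0 : c = 0 := by
    by_contra hne
    have hε : 0 < |c| / (2 * Real.pi) := by positivity
    obtain ⟨δ, hδ, hball⟩ := Metric.eventually_nhds_iff.1
      (hea.continuousAt.eventually (Metric.ball_mem_nhds _ hε))
    obtain ⟨A, h1, h2, h3⟩ := (hec.and (hpos.and
      (nhdsWithin_le_nhds (gt_mem_nhds hδ) : ∀ᶠ A in 𝓝[>] (0 : ℝ), A < δ))).exists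
    have h4 : ‖∫ s in (0 : ℝ)..2 * Real.pi, e (A * Real.cos s)‖
        ≤ |c| / (2 * Real.pi) * |2 * Real.pi - 0| := by
      refine intervalIntegral.norm_integral_le_of_norm_le_const fun s _ => ?_
      have h5 : dist (A * Real.cos s) 0 < δ := by
        rw [Real.dist_0_eq_abs]
        exact abs_mul_cos_lt h2 h3 s
      have h6 : dist (e (A * Real.cos s)) (e 0) < _ := hball h5
      rw [he0, Real.dist_0_eq_abs] at h6
      exact h6.le
    rw [h1, sub_zero, abs_of_pos Real.two_pi_pos, div_mul_cancel₀ _ Real.two_pi_pos.ne',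
      Real.norm_eq_abs, abs_mul, abs_two] at h4
    have := abs_pos.2 hne
    linarith
  have hev : ∀ᶠ ξ in 𝓝 (0 : ℝ), e ξ = 0 := by
    by_contra hne
    -- Otherwise e = ξⁿ q with q(0) ≠ 0 has a fixed sign for small ξ > 0, hence by evenness for
    -- small ξ ≠ 0, and its circle integral cannot vanish.
    obtain ⟨n, q, hq, hq0, hqe⟩ := hea.exists_eventuallyEq_pow_smul_nonzero_iff.2 hne
    have hqpos : ∀ᶠ ξ in 𝓝 (0 : ℝ), 0 < q 0 * q ξ :=
      (continuousAt_const.mul hq.continuousAt).eventually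
        (lt_mem_nhds (mul_self_pos.2 hq0))
    obtain ⟨δ, hδ, hball⟩ := Metric.eventually_nhds_iff.1 (hqe.and hqpos)
    have h1 : ∀ ξ, 0 < ξ → ξ < δ → 0 < q 0 * e ξ := by
      intro ξ h0 h1
      obtain ⟨h2, h3⟩ := hball (y := ξ) (by rwa [Real.dist_0_eq_abs, abs_of_pos h0])
      rw [h2, sub_zero, smul_eq_mul, mul_left_comm]
      positivity
    have heven : ∀ ξ, e ξ = e |ξ| := by
      intro ξ
      rcases abs_choice ξ with h | h <;> rw [h]
      simp [he, add_comm]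
    obtain ⟨A, h2, h3, h4, h5⟩ := (hec.and (hpos.and (hlt.and
      (nhdsWithin_le_nhds (gt_mem_nhds hδ) : ∀ᶠ A in 𝓝[>] (0 : ℝ), A < δ)))).exists
    have h6 : 0 < ∫ s in (0 : ℝ)..2 * Real.pi, q 0 * e (A * Real.cos s) := by
      refine intervalIntegral.integral_pos Real.two_pi_pos
        (continuous_const.mul (hecont A h3 h4)).continuousOn (fun s _ => ?_)
        ⟨0, ⟨le_rfl, Real.two_pi_pos.le⟩, ?_⟩
      · rw [heven]
        rcases eq_or_ne (A * Real.cos s) 0 with h | h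
        · simp [h, he0]
        · exact (h1 _ (abs_pos.2 h) (abs_mul_cos_lt h3 h5 s)).le
      · simpa using h1 A h3 h5
    rw [intervalIntegral.integral_const_mul, h2, hc0] at h6
    simp at h6
  filter_upwards [hev] with ξ hξ
  simp only [he] at hξ
  linarith

/-- Uniqueness of solutions identifies the given orbit through `(a A, 0)` with the energy circle of
radius A, so T = 2π + ∫ h(A cos s) ds for all small A. -/
theorem exists_odd_of_hasIsochronousCenter {f g F a h : ℝ → ℝ} {U : Set ℝ} {r : ℝ}
    (hf : AnalyticOnNhd ℝ f U) (hg : AnalyticOnNhd ℝ g U) (H : IsEnergyGerm g F a h)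
    (hr : 0 < r) (Hr : IsEnergyChart f g F a h U r)
    (hiso : HasIsochronousCenter (lienardField f g) {z : ℝ × ℝ | z.1 ∈ U} (0, 0)) :
    IsOddAnalytic h := by
  obtain ⟨-, T, V, hV, hT⟩ := hiso
  have hlt : ∀ᶠ A in 𝓝[>] (0 : ℝ), A < r := nhdsWithin_le_nhds (gt_mem_nhds hr)
  have hpos : ∀ᶠ A in 𝓝[>] (0 : ℝ), 0 < A := self_mem_nhdsWithin
  have hta : Filter.Tendsto (fun A => (a A, (0 : ℝ))) (𝓝 0) (𝓝 (0, 0)) :=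
    (H.analyticAt.tendsto_zero H.map_zero).prodMk_nhds tendsto_const_nhds
  have hcont : ∀ A, 0 < A → A < r → Continuous fun s => h (A * Real.cos s) := by
    intro A hA hAr
    refine ((Hr.continuous_speed hA hAr).sub (continuous_const (y := (1 : ℝ)))).congr fun s => ?_
    simp
  refine ⟨H.analyticAt_speed, eventually_odd_of_integral_const (c := T - 2 * Real.pi)
    H.analyticAt_speed H.speed_zero hr hcont ?_⟩
  filter_upwards [hlt, hpos, nhdsWithin_le_nhds (hta.eventually hV)] with A hAr hA hAV
  have hne : (a A, (0 : ℝ)) ≠ (0, 0) := by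
    intro h0
    have h1 : a A = a 0 := by rw [H.map_zero]; exact congrArg Prod.fst h0
    exact hA.ne' (Hr.injOn ⟨by linarith, hAr⟩ ⟨by linarith, hr⟩ h1)
  obtain ⟨γ, hγ, hγ0⟩ := hT _ hAV hne
  obtain ⟨δ, hδ, hδ0⟩ := Hr.exists_periodic hA hAr 0
  have h1 : γ = δ := by
    refine eq_of_hasDerivAt_of_contDiffAt
      (fun t => contDiffAt_lienardField (hf _ (hγ.mem t)) (hg _ (hγ.mem t)))
      hγ.hasDerivAt hδ.hasDerivAt ?_
    rw [hγ0, hδ0]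
    simp
  subst h1
  have h2 := hγ.period_eq hδ
  rw [intervalIntegral.integral_add (by simp) ((hcont A hA hAr).intervalIntegrable _ _)] at h2
  simp at h2
  linarith

/-- For odd h the half turn gives ∫ h(A cos s) ds = 0, so every small energy circle has period 2π.
-/
theorem hasIsochronousCenter_of_odd {f g F a h : ℝ → ℝ} {U : Set ℝ} {r : ℝ} (hg0 : g 0 = 0)
    (hF : AnalyticAt ℝ F 0) (hF0 : F 0 = 0) (H : IsEnergyGerm g F a h) (hr : 0 < r)
    (Hr : IsEnergyChart f g F a h U r) (hodd : ∀ᶠ ξ in 𝓝 (0 : ℝ), h (-ξ) = -h ξ) :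
    HasIsochronousCenter (lienardField f g) {z : ℝ × ℝ | z.1 ∈ U} (0, 0) := by
  refine ⟨by simp [lienardField, hg0], 2 * Real.pi, ?_⟩
  have ha1 : deriv a 0 = 1 := by
    rw [H.hasDerivAt.self_of_nhds.deriv]
    simp [H.map_zero, hF0, H.speed_zero]
  obtain ⟨b, hb, hb0, -, -, hab⟩ := H.analyticAt.exists_local_inverse H.map_zero ha1
  obtain ⟨δ, hδ, hball⟩ := Metric.eventually_nhds_iff.1 hodd
  simp only [Real.dist_0_eq_abs] at hball
  -- N(p) = ξ + iη: its modulus and argument are the radius and initial angle of the circle through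
  -- p.
  set N : ℝ × ℝ → ℂ := fun p => ⟨b p.1, -(Real.exp (F p.1) * p.2)⟩ with hN
  have hNc : ContinuousAt (fun p => ‖N p‖) (0, 0) := by
    have h1 : ContinuousAt (fun p : ℝ × ℝ => b p.1) (0, 0) :=
      ContinuousAt.comp (f := Prod.fst) hb.continuousAt continuousAt_fst
    have h2 : ContinuousAt (fun p : ℝ × ℝ => F p.1) (0, 0) :=
      ContinuousAt.comp (f := Prod.fst) hF.continuousAt continuousAt_fst
    have h3 : ContinuousAt (fun p : ℝ × ℝ => -(Real.exp (F p.1) * p.2)) (0, 0) :=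
      (h2.rexp.mul continuousAt_snd).neg
    refine ContinuousAt.norm ?_
    have h4 := Complex.equivRealProdCLM.symm.continuous.continuousAt.comp (h1.prodMk h3)
    exact h4
  have hN0 : ‖N (0, 0)‖ = 0 := by
    rw [norm_eq_zero, Complex.ext_iff]
    simp [hN, hb0]
  have hsmall : ∀ᶠ p in 𝓝 ((0, 0) : ℝ × ℝ), ‖N p‖ < min r δ :=
    hNc.eventually (gt_mem_nhds (hN0.trans_lt (lt_min hr hδ)))
  have hab' : ∀ᶠ p in 𝓝 ((0, 0) : ℝ × ℝ), a (b p.1) = p.1 :=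
    (continuousAt_fst : ContinuousAt Prod.fst ((0, 0) : ℝ × ℝ)).eventually hab
  refine ⟨_, hsmall.and hab', fun p hp hp0 => ?_⟩
  obtain ⟨hp1, hp2⟩ := hp
  obtain ⟨hpr, hpδ⟩ := lt_min_iff.1 hp1
  have hA : 0 < ‖N p‖ := by
    rw [norm_pos_iff]
    intro h0
    rw [Complex.ext_iff] at h0
    have h1 : b p.1 = 0 := h0.1
    have h2 : -(Real.exp (F p.1) * p.2) = 0 := h0.2
    rw [h1, H.map_zero] at hp2
    have h3 : p.2 = 0 := by
      simpa [(Real.exp_pos _).ne'] using h2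
    exact hp0 (Prod.ext hp2.symm h3)
  obtain ⟨γ, hγ, hγ0⟩ := Hr.exists_periodic hA hpr (Complex.arg (N p))
  refine ⟨γ, ?_, ?_⟩
  · convert hγ using 1
    have hcont : Continuous fun s => h (‖N p‖ * Real.cos s) := by
      refine ((Hr.continuous_speed hA hpr).sub (continuous_const (y := (1 : ℝ)))).congr fun s => ?_
      simp
    have h1 : ∫ s in (0 : ℝ)..2 * Real.pi, h (-(‖N p‖ * Real.cos s))
        = ∫ s in (0 : ℝ)..2 * Real.pi, -h (‖N p‖ * Real.cos s) := by
      refine intervalIntegral.integral_congr fun s _ => ?_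
      exact hball (abs_mul_cos_lt hA hpδ s)
    rw [integral_comp_neg_cos, intervalIntegral.integral_neg] at h1
    rw [intervalIntegral.integral_add (by simp) (hcont.intervalIntegrable _ _)]
    simp
    linarith
  · rw [hγ0, Complex.norm_mul_cos_arg, Complex.norm_mul_sin_arg]
    have h1 : (N p).re = b p.1 := rfl
    have h2 : (N p).im = -(Real.exp (F p.1) * p.2) := rfl
    rw [h1, h2, hp2]
    refine Prod.ext rfl ?_
    simp only
    rw [mul_neg, neg_neg, ← mul_assoc, ← Real.exp_add]
    simp

/-! ### The main theorem -/

theorem theorem2 (U : Set ℝ) (hU : IsOpen U) (h0U : (0 : ℝ) ∈ U) (f g : ℝ → ℝ)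
    (hf : AnalyticOnNhd ℝ f U) (hg : AnalyticOnNhd ℝ g U)
    (hg0 : g 0 = 0) (hg1 : deriv g 0 = 1)
    (hpos : ∀ᶠ x in 𝓝 (0 : ℝ), x ≠ 0 → 0 < x * g x) :
    (HasIsochronousCenter (lienardField f g) {z : ℝ × ℝ | z.1 ∈ U} (0, 0) ↔
      ∃ h : ℝ → ℝ, IsOddAnalytic h ∧ ∀ k : ℕ, Phat h k 0 = Qhat f g k 0) ∧
    (∀ h : ℝ → ℝ, IsOddAnalytic h → ∀ M : ℕ, 0 < M → ∀ k : ℕ, k ≤ M →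
      PhatTrunc (maclaurin h) M k = truncAt (M - k) (maclaurin (Phat h k)) ∧
      QhatTrunc (maclaurin f) (maclaurin g) M k =
        truncAt (M - k) (maclaurin (Qhat f g k)) ∧
      (Phat h k 0 = Qhat f g k 0 ↔
        (PhatTrunc (maclaurin h) M k).eval 0 =
          (QhatTrunc (maclaurin f) (maclaurin g) M k).eval 0)) := by
  have hf0 := hf 0 h0U
  have hg' := hg 0 h0U
  have hU0 : U ∈ 𝓝 (0 : ℝ) := hU.mem_nhds h0U
  obtain ⟨F, hF, hF0, hFd⟩ := hf0.exists_primitive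
  refine ⟨⟨fun hiso => ?_, ?_⟩, fun h hh M _ k hk => ?_⟩
  · obtain ⟨a, h, H⟩ := exists_isEnergyGerm hg' hg0 hg1 hF hF0
    obtain ⟨r, hr, Hr⟩ := H.exists_isEnergyChart hU0 hFd
    exact ⟨h, exists_odd_of_hasIsochronousCenter hf hg H hr Hr hiso,
      (forall_Phat_eq_Qhat_iff hf0 hg' hF hF0 hFd H.analyticAt_speed H.speed_zero).2 ⟨a, H⟩⟩
  · rintro ⟨h, ⟨hh, hodd⟩, hPQ⟩
    have hh0 : h 0 = 0 := by
      have h1 := hodd.self_of_nhds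
      rw [neg_zero] at h1
      linarith
    obtain ⟨a, H⟩ := (forall_Phat_eq_Qhat_iff hf0 hg' hF hF0 hFd hh hh0).1 hPQ
    obtain ⟨r, hr, Hr⟩ := H.exists_isEnergyChart hU0 hFd
    exact hasIsochronousCenter_of_odd hg0 hF hF0 H hr Hr hodd
  · have hP := PhatTrunc_eq hh.1 M k hk
    have hQ := QhatTrunc_eq hf0 hg' M k hk
    refine ⟨hP, hQ, ?_⟩
    rw [hP, hQ, eval_zero_truncAt_maclaurin, eval_zero_truncAt_maclaurin]
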